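/- Let $Q$ be a group. Write $x^y=y^{-1}xy$ and $[x,y]=x^{-1}y^{-1}xy$, and let $G'$ denote the derived subgroup of a group $G$. Let $Q\wedge Q$ be the group generated by symbols $x\wedge y$ $(x,y\in Q)$ subject to the relations $xy\wedge z=(x^y\wedge z^y)(y\wedge z)$, $x\wedge yz=(x\wedge z)(x^z\wedge y^z)$ and $x\wedge x=1$ for all $x,y,z\in Q$. Let $M(Q)$ be the kernel of the homomorphism $Q\wedge Q\to Q'$, $x\wedge y\mapsto[x,y]$, let $M_0(Q)=\langle x\wedge y\mid x,y\in Q,\ [x,y]=1\rangle\le M(Q)$, and let $B_0(Q)=M(Q)/M_0(Q)$ be the Bogomolov multiplier of $Q$. A homomorphism $f\colon Q\to R$ induces $B_0(f)\colon B_0(Q)\to B_0(R)$ via $x\wedge y\mapsto f(x)\wedge f(y)$. A central CP extension with factor group isomorphic to $Q$ is a short exact sequence of groups $$e\colon\ 1\to N\xrightarrow{\ \chi\ }G\xrightarrow{\ \pi\ }F\to1$$ with $F\cong Q$ and $\chi(N)\le Z(G)$ such that any two commuting elements of $F$ have lifts in $G$ that commute. Let $c\colon F\times F\to G'$ be the well-defined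 map $c(\pi(g),\pi(h))=[g,h]$. Two such extensions $e_1,e_2$ (with groups $G_i,F_i$ and maps $c_i$) are isoclinic if there are isomorphisms $\eta\colon F_1\to F_2$ and $\xi\colon G_1'\to G_2'$ with $\xi(c_1(x,y))=c_2(\eta(x),\eta(y))$ for all $x,y\in F_1$. For a central CP extension $e$ let $\tilde\theta(e)\colon B_0(F)\to N$ be the well-defined homomorphism that sends the class of $\prod_i(\pi(g_i)\wedge\pi(h_i))^{\epsilon_i}\in M(F)$, with $\epsilon_i=\pm1$, to $\chi^{-1}\bigl(\prod_i[g_i,h_i]^{\epsilon_i}\bigr)$. **Theorem.** The isoclinism classes of central CP extensions with factor group isomorphic to $Q$ are in bijective correspondence with the orbits of the action of $\operatorname{Aut}Q$ on the set of subgroups of $B_0(Q)$ given by $(\varphi,U)\mapsto B_0(\varphi)U$. More precisely, there is a bijection that sends, for every such extension $e$ and every isomorphism $\alpha\colon F\to Q$, the isoclinism class of $e$ to the orbit of the subgroup $B_0(\alpha)\bigl(\ker\tilde\theta(e)\bigr)$. -/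

import Mathlib

universe u

namespace CPExt

/-- The conjugate `x ^ y = y⁻¹ x y`. -/
def conj {G : Type u} [Group G] (x y : G) : G := y⁻¹ * x * y

/-- The commutator `[x, y] = x⁻¹ y⁻¹ x y`. -/
def comm {G : Type u} [Group G] (x y : G) : G := x⁻¹ * y⁻¹ * x * y

theorem comm_eq_one_iff {G : Type u} [Group G] (x y : G) : comm x y = 1 ↔ Commute x y := by
  unfold comm
  constructor
  · intro h
    have h2 : x * y = (y * x) * (x⁻¹ * y⁻¹ * x * y) := by group
    rw [h, mul_one] at h2
    exact h2
  · intro h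
    have h2 : x⁻¹ * y⁻¹ * x * y = x⁻¹ * y⁻¹ * (x * y) := by group
    rw [h2, h.eq]
    group

theorem comm_mem_commutator {G : Type u} [Group G] (x y : G) : comm x y ∈ commutator G := by
  have h : comm x y = x⁻¹ * y⁻¹ * (x⁻¹)⁻¹ * (y⁻¹)⁻¹ := by
    simp [comm]
  rw [h, ← commutatorElement_def]
  exact Subgroup.commutator_mem_commutator (Subgroup.mem_top _) (Subgroup.mem_top _)

theorem map_comm {G H : Type u} [Group G] [Group H] (f : G →* H) (x y : G) :
    f (comm x y) = comm (f x) (f y) := by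
  simp [comm]

/-! ### The non-abelian exterior square and the Bogomolov multiplier -/

/-- The defining relators of the non-abelian exterior square; the generator `(x, y)` stands for
`x ∧ y`. -/
inductive IsExtRelator (Q : Type u) [Group Q] : FreeGroup (Q × Q) → Prop
  /-- `x y ∧ z = (x ^ y ∧ z ^ y) (y ∧ z)` -/
  | mul_left (x y z : Q) : IsExtRelator Q
      ((FreeGroup.of (x * y, z))⁻¹ *
        (FreeGroup.of (conj x y, conj z y) * FreeGroup.of (y, z)))
  /-- `x ∧ y z = (x ∧ z) (x ^ z ∧ y ^ z)` -/
  | mul_right (x y z : Q) : IsExtRelator Q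
      ((FreeGroup.of (x, y * z))⁻¹ *
        (FreeGroup.of (x, z) * FreeGroup.of (conj x z, conj y z)))
  /-- `x ∧ x = 1` -/
  | self (x : Q) : IsExtRelator Q (FreeGroup.of (x, x))

/-- The non-abelian exterior square `Q ∧ Q`. -/
abbrev ExtSquare (Q : Type u) [Group Q] : Type u :=
  PresentedGroup {r : FreeGroup (Q × Q) | IsExtRelator Q r}

/-- The generator `x ∧ y` of `Q ∧ Q`. -/
def wedge {Q : Type u} [Group Q] (x y : Q) : ExtSquare Q :=
  PresentedGroup.of (x, y)

section ExtSquare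

variable {Q : Type u} [Group Q]

theorem wedge_mul_left (x y z : Q) :
    wedge (x * y) z = wedge (conj x y) (conj z y) * wedge y z := by
  have h := PresentedGroup.one_of_mem (rels := {r : FreeGroup (Q × Q) | IsExtRelator Q r})
    (IsExtRelator.mul_left x y z)
  rw [map_mul, map_inv, map_mul] at h
  exact inv_mul_eq_one.mp h

theorem wedge_mul_right (x y z : Q) :
    wedge x (y * z) = wedge x z * wedge (conj x z) (conj y z) := by
  have h := PresentedGroup.one_of_mem (rels := {r : FreeGroup (Q × Q) | IsExtRelator Q r})
    (IsExtRelator.mul_right x y z)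
  rw [map_mul, map_inv, map_mul] at h
  exact inv_mul_eq_one.mp h

theorem wedge_self (x : Q) : wedge x x = 1 :=
  PresentedGroup.one_of_mem (rels := {r : FreeGroup (Q × Q) | IsExtRelator Q r})
    (IsExtRelator.self x)

/-- The homomorphism on `Q ∧ Q` with prescribed values on the generators `x ∧ y`. -/
def ExtSquare.lift {H : Type u} [Group H] (f : Q → Q → H)
    (h1 : ∀ x y z, f (x * y) z = f (conj x y) (conj z y) * f y z)
    (h2 : ∀ x y z, f x (y * z) = f x z * f (conj x z) (conj y z))
    (h3 : ∀ x, f x x = 1) : ExtSquare Q →* H :=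
  PresentedGroup.toGroup (f := fun p : Q × Q => f p.1 p.2) (by
    rintro r (⟨x, y, z⟩ | ⟨x, y, z⟩ | ⟨x⟩)
    · simp [h1 x y z]
    · simp [h2 x y z]
    · simp [h3 x])

@[simp]
theorem ExtSquare.lift_wedge {H : Type u} [Group H] (f : Q → Q → H)
    (h1 : ∀ x y z, f (x * y) z = f (conj x y) (conj z y) * f y z)
    (h2 : ∀ x y z, f x (y * z) = f x z * f (conj x z) (conj y z))
    (h3 : ∀ x, f x x = 1) (x y : Q) : ExtSquare.lift f h1 h2 h3 (wedge x y) = f x y :=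
  PresentedGroup.toGroup.of _

theorem ExtSquare.hom_ext {H : Type u} [Group H] {f g : ExtSquare Q →* H}
    (h : ∀ x y, f (wedge x y) = g (wedge x y)) : f = g :=
  PresentedGroup.ext fun p => h p.1 p.2

theorem ExtSquare.closure_wedge :
    Subgroup.closure {w : ExtSquare Q | ∃ x y, w = wedge x y} = ⊤ := by
  rw [eq_top_iff, ← PresentedGroup.closure_range_of]
  apply Subgroup.closure_mono
  rintro _ ⟨p, rfl⟩
  exact ⟨p.1, p.2, rfl⟩

/-- The commutator homomorphism `Q ∧ Q → [Q, Q]`, `x ∧ y ↦ [x, y]`. -/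
def commHom (Q : Type u) [Group Q] : ExtSquare Q →* commutator Q :=
  ExtSquare.lift (fun x y => ⟨comm x y, comm_mem_commutator x y⟩)
    (fun x y z => Subtype.ext (by simp only [comm, conj, Subgroup.coe_mul]; group))
    (fun x y z => Subtype.ext (by simp only [comm, conj, Subgroup.coe_mul]; group))
    (fun x => Subtype.ext (by simp [comm]))

@[simp]
theorem commHom_wedge (x y : Q) : (commHom Q (wedge x y) : Q) = comm x y := by
  simp [commHom]

/-- The group `M(Q)`, the kernel of the commutator homomorphism `Q ∧ Q → [Q, Q]`. -/
def M (Q : Type u) [Group Q] : Subgroup (ExtSquare Q) := (commHom Q).ker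

/-- The group `M₀(Q) = ⟨x ∧ y ∣ [x, y] = 1⟩`. -/
def M₀ (Q : Type u) [Group Q] : Subgroup (ExtSquare Q) :=
  Subgroup.closure {w | ∃ x y : Q, comm x y = 1 ∧ w = wedge x y}

theorem wedge_mul_wedge (x z y w : Q) :
    wedge x z * wedge y w = wedge y w * wedge (conj x (comm y w)) (conj z (comm y w)) := by
  have key : ∀ x z : Q, wedge (conj x (w * y)) (conj z (w * y)) * wedge y w
      = wedge y w * wedge (conj x (y * w)) (conj z (y * w)) := by
    intro x z
    have hc : ∀ a : Q, conj (conj a y) (conj w y) = conj a (w * y) := by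
      intro a; simp only [conj]; group
    have hd : ∀ a : Q, conj (conj a w) (conj y w) = conj a (y * w) := by
      intro a; simp only [conj]; group
    have hm : ∀ a b c : Q, conj (a * b) c = conj a c * conj b c := by
      intro a b c; simp only [conj]; group
    have e1 : wedge (x * y) (z * w) = wedge (conj x y) (conj w y) *
        wedge (conj x (w * y)) (conj z (w * y)) * (wedge y w * wedge (conj y w) (conj z w)) := by
      rw [wedge_mul_left, hm, wedge_mul_right, wedge_mul_right, hc, hc]
    have e2 : wedge (x * y) (z * w) = wedge (conj x y) (conj w y) * wedge y w *
        (wedge (conj x (y * w)) (conj z (y * w)) * wedge (conj y w) (conj z w)) := by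
      rw [wedge_mul_right, hm, wedge_mul_left, wedge_mul_left, hd, hd]
    rw [e1] at e2
    simp only [mul_assoc] at e2
    have e3 := mul_left_cancel e2
    simp only [← mul_assoc] at e3
    exact mul_right_cancel e3
  have hx : ∀ a : Q, conj (conj a (w * y)⁻¹) (w * y) = a := by
    intro a; simp only [conj]; group
  have hy : ∀ a : Q, conj (conj a (w * y)⁻¹) (y * w) = conj a (comm y w) := by
    intro a; simp only [conj, comm]; group
  have := key (conj x (w * y)⁻¹) (conj z (w * y)⁻¹)
  rwa [hx, hx, hy, hy] at this

theorem wedge_mul_eq (g : ExtSquare Q) : ∀ x z : Q,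
    wedge x z * g = g * wedge (conj x (commHom Q g)) (conj z (commHom Q g)) := by
  have hg : g ∈ Subgroup.closure {w : ExtSquare Q | ∃ x y, w = wedge x y} := by
    rw [ExtSquare.closure_wedge]; exact Subgroup.mem_top _
  induction hg using Subgroup.closure_induction with
  | mem g hg =>
    obtain ⟨y, w, rfl⟩ := hg
    intro x z
    rw [commHom_wedge]
    exact wedge_mul_wedge x z y w
  | one => intro x z; simp [conj]
  | mul a b _ _ ha hb =>
    intro x z
    rw [← mul_assoc, ha, mul_assoc, hb, ← mul_assoc, map_mul]
    have : ∀ t : Q, conj (conj t (commHom Q a)) (commHom Q b)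
        = conj t ((commHom Q a * commHom Q b : commutator Q) : Q) := by
      intro t; simp only [conj, Subgroup.coe_mul]; group
    rw [this, this]
  | inv a _ ha =>
    intro x z
    have h := ha (conj x (commHom Q a)⁻¹) (conj z (commHom Q a)⁻¹)
    have hx : ∀ t : Q, conj (conj t (commHom Q a : Q)⁻¹) (commHom Q a) = t := by
      intro t; simp only [conj]; group
    rw [hx, hx] at h
    rw [map_inv, Subgroup.coe_inv, mul_inv_eq_iff_eq_mul, mul_assoc, h, inv_mul_cancel_left]

theorem M_le_center : M Q ≤ Subgroup.center (ExtSquare Q) := by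
  intro g hg
  rw [Subgroup.mem_center_iff]
  intro h
  have hh : h ∈ Subgroup.closure {w : ExtSquare Q | ∃ x y, w = wedge x y} := by
    rw [ExtSquare.closure_wedge]; exact Subgroup.mem_top _
  have hg' : commHom Q g = 1 := hg
  suffices Subgroup.closure {w : ExtSquare Q | ∃ x y, w = wedge x y} ≤
      Subgroup.centralizer {g} from
    ((Subgroup.mem_centralizer_singleton_iff).mp (this hh))
  rw [Subgroup.closure_le]
  rintro _ ⟨x, y, rfl⟩
  rw [SetLike.mem_coe, Subgroup.mem_centralizer_singleton_iff, wedge_mul_eq g x y, hg']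
  simp [conj]

theorem M₀_le_M : M₀ Q ≤ M Q := by
  rw [M₀, Subgroup.closure_le]
  rintro _ ⟨x, y, hxy, rfl⟩
  exact MonoidHom.mem_ker.mpr (Subtype.ext (by simpa using hxy))

instance M₀_normal : ((M₀ Q).subgroupOf (M Q)).Normal where
  conj_mem n hn g := by
    have h : g * n = n * g :=
      Subtype.ext ((Subgroup.mem_center_iff.mp (M_le_center n.2)) g)
    rwa [h, mul_inv_cancel_right]

end ExtSquare

/-- The Bogomolov multiplier `B₀(Q) = M(Q) / M₀(Q)`. -/
abbrev B₀ (Q : Type u) [Group Q] : Type u := M Q ⧸ (M₀ Q).subgroupOf (M Q)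

section Functoriality

variable {Q R S : Type u} [Group Q] [Group R] [Group S]

/-- The homomorphism `Q ∧ Q → R ∧ R`, `x ∧ y ↦ f x ∧ f y`. -/
def ExtSquare.map (f : Q →* R) : ExtSquare Q →* ExtSquare R :=
  ExtSquare.lift (fun x y => wedge (f x) (f y))
    (fun x y z => by
      simp only [conj, map_mul, map_inv]
      exact wedge_mul_left _ _ _)
    (fun x y z => by
      simp only [conj, map_mul, map_inv]
      exact wedge_mul_right _ _ _)
    (fun x => wedge_self _)

@[simp]
theorem ExtSquare.map_wedge (f : Q →* R) (x y : Q) :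
    ExtSquare.map f (wedge x y) = wedge (f x) (f y) := by
  simp [ExtSquare.map]

theorem commHom_map (f : Q →* R) (g : ExtSquare Q) :
    (commHom R (ExtSquare.map f g) : R) = f (commHom Q g) := by
  have : ((commutator R).subtype.comp (commHom R)).comp (ExtSquare.map f) =
      f.comp ((commutator Q).subtype.comp (commHom Q)) :=
    ExtSquare.hom_ext fun x y => by simp [map_comm]
  exact DFunLike.congr_fun this g

theorem map_mem_M (f : Q →* R) {g : ExtSquare Q} (hg : g ∈ M Q) : ExtSquare.map f g ∈ M R := by
  have h : commHom Q g = 1 := hg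
  refine MonoidHom.mem_ker.mpr (Subtype.ext ?_)
  rw [commHom_map, h]
  simp

theorem map_mem_M₀ (f : Q →* R) {g : ExtSquare Q} (hg : g ∈ M₀ Q) :
    ExtSquare.map f g ∈ M₀ R := by
  suffices M₀ Q ≤ (M₀ R).comap (ExtSquare.map f) from this hg
  rw [M₀, Subgroup.closure_le]
  rintro _ ⟨x, y, hxy, rfl⟩
  refine Subgroup.subset_closure ⟨f x, f y, ?_, by simp⟩
  rw [← map_comm, hxy, map_one]

/-- The homomorphism `M(f) : M(Q) → M(R)` induced by `f : Q → R`. -/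
def M.map (f : Q →* R) : M Q →* M R :=
  ((ExtSquare.map f).comp (M Q).subtype).codRestrict (M R) fun g => map_mem_M f g.2

@[simp]
theorem M.coe_map (f : Q →* R) (g : M Q) :
    (M.map f g : ExtSquare R) = ExtSquare.map f g := rfl

/-- The homomorphism `B₀(f) : B₀(Q) → B₀(R)` induced by `f : Q → R`. -/
def B₀.map (f : Q →* R) : B₀ Q →* B₀ R :=
  QuotientGroup.map _ _ (M.map f) fun _ hg => map_mem_M₀ f hg

theorem B₀.map_id : B₀.map (MonoidHom.id Q) = MonoidHom.id (B₀ Q) := by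
  have h : ExtSquare.map (MonoidHom.id Q) = MonoidHom.id (ExtSquare Q) :=
    ExtSquare.hom_ext fun x y => by simp
  refine QuotientGroup.monoidHom_ext _ (MonoidHom.ext fun g => ?_)
  refine congrArg (QuotientGroup.mk' _) (Subtype.ext ?_)
  rw [M.coe_map, h]
  rfl

theorem B₀.map_comp (f : Q →* R) (g : R →* S) :
    B₀.map (g.comp f) = (B₀.map g).comp (B₀.map f) := by
  have h : ExtSquare.map (g.comp f) = (ExtSquare.map g).comp (ExtSquare.map f) :=
    ExtSquare.hom_ext fun x y => by simp
  refine QuotientGroup.monoidHom_ext _ (MonoidHom.ext fun z => ?_)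
  refine congrArg (QuotientGroup.mk' _) (Subtype.ext ?_)
  rw [M.coe_map, h]
  rfl

/-- The action of `Aut Q` on the set of subgroups of `B₀(Q)`, `(φ, U) ↦ B₀(φ) U`. -/
instance autAction (Q : Type u) [Group Q] : MulAction (MulAut Q) (Subgroup (B₀ Q)) where
  smul φ U := U.map (B₀.map (φ : Q ≃* Q).toMonoidHom)
  one_smul U := by
    change U.map (B₀.map (MonoidHom.id Q)) = U
    rw [B₀.map_id, Subgroup.map_id]
  mul_smul φ ψ U := by
    change U.map (B₀.map ((φ : Q ≃* Q).toMonoidHom.comp (ψ : Q ≃* Q).toMonoidHom)) =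
      (U.map (B₀.map (ψ : Q ≃* Q).toMonoidHom)).map (B₀.map (φ : Q ≃* Q).toMonoidHom)
    rw [B₀.map_comp, Subgroup.map_map]

end Functoriality

/-! ### Central CP extensions and isoclinism -/

section Extensions

variable {N G F : Type u} [Group N] [Group G] [Group F]

/-- The extension `e` is central: the image of the kernel lies in the centre. -/
def IsCentral (e : GroupExtension N G F) : Prop := e.inl.range ≤ Subgroup.center G

/-- The extension `e` is commutativity preserving (CP): commuting pairs of elements of the factor
group have commuting lifts. -/
def IsCP (e : GroupExtension N G F) : Prop :=
  ∀ x y : F, Commute x y → ∃ g h : G, e.rightHom g = x ∧ e.rightHom h = y ∧ Commute g h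

/-- The map `c : F × F → G'`, `c(π g, π h) = [g, h]` of an extension with factor group `F`. It is
defined through a choice of lifts; for central extensions it does not depend on the choice,
see `commMap_rightHom`. -/
noncomputable def commMap (e : GroupExtension N G F) (x y : F) : commutator G :=
  ⟨comm (Function.surjInv e.rightHom_surjective x) (Function.surjInv e.rightHom_surjective y),
    comm_mem_commutator _ _⟩

theorem comm_congr {e : GroupExtension N G F} (he : IsCentral e) {g g' h h' : G}
    (hg : e.rightHom g = e.rightHom g') (hh : e.rightHom h = e.rightHom h') :
    comm g h = comm g' h' := by
  have aux : ∀ {a a' : G}, e.rightHom a = e.rightHom a' →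
      ∃ z ∈ Subgroup.center G, a = a' * z := by
    intro a a' haa
    refine ⟨a'⁻¹ * a, he ?_, by group⟩
    rw [e.range_inl_eq_ker_rightHom, MonoidHom.mem_ker, map_mul, map_inv, haa, inv_mul_cancel]
  obtain ⟨z, hz, rfl⟩ := aux hg
  obtain ⟨w, hw, rfl⟩ := aux hh
  rw [Subgroup.mem_center_iff] at hz hw
  have hz' : ∀ t, t * z = z * t := hz
  have hw' : ∀ t, t * w = w * t := hw
  unfold comm
  have e1 : g' * z = z * g' := hz' _
  have e2 : h' * w = w * h' := hw' _
  calc (g' * z)⁻¹ * (h' * w)⁻¹ * (g' * z) * (h' * w)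
      = (z * g')⁻¹ * (w * h')⁻¹ * (z * g') * (w * h') := by rw [e1, e2]
    _ = g'⁻¹ * (z⁻¹ * h'⁻¹) * w⁻¹ * (z * (g' * w)) * h' := by group
    _ = g'⁻¹ * (z⁻¹ * h'⁻¹) * w⁻¹ * (z * (w * g')) * h' := by rw [hw' g']
    _ = g'⁻¹ * (z⁻¹ * h'⁻¹) * w⁻¹ * ((z * w) * g') * h' := by group
    _ = g'⁻¹ * (z⁻¹ * h'⁻¹) * w⁻¹ * ((w * z) * g') * h' := by rw [hw' z]
    _ = g'⁻¹ * z⁻¹ * (h'⁻¹ * z) * g' * h' := by group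
    _ = g'⁻¹ * z⁻¹ * (z * h'⁻¹) * g' * h' := by rw [hz' h'⁻¹]
    _ = g'⁻¹ * h'⁻¹ * g' * h' := by group

theorem commMap_rightHom {e : GroupExtension N G F} (he : IsCentral e) (g h : G) :
    (commMap e (e.rightHom g) (e.rightHom h) : G) = comm g h :=
  comm_congr he (Function.surjInv_eq _ _) (Function.surjInv_eq _ _)

/-- Isoclinism of (central) extensions: there are isomorphisms `η : F₁ → F₂` of the factor groups
and `ξ : G₁' → G₂'` of the derived subgroups such that `ξ (c₁ (x, y)) = c₂ (η x, η y)`. -/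
def Isoclinic {N₁ G₁ F₁ N₂ G₂ F₂ : Type u} [Group N₁] [Group G₁] [Group F₁]
    [Group N₂] [Group G₂] [Group F₂]
    (e₁ : GroupExtension N₁ G₁ F₁) (e₂ : GroupExtension N₂ G₂ F₂) : Prop :=
  ∃ (η : F₁ ≃* F₂) (ξ : commutator G₁ ≃* commutator G₂),
    ∀ x y : F₁, ξ (commMap e₁ x y) = commMap e₂ (η x) (η y)

/-- For a central extension `e` of `N` by `F`, the homomorphism `F ∧ F → G'`,
`x ∧ y ↦ c(x, y) = [g, h]`, where `g` and `h` are lifts of `x` and `y`. -/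
noncomputable def extCommHom (e : GroupExtension N G F) (he : IsCentral e) :
    ExtSquare F →* commutator G :=
  ExtSquare.lift (commMap e)
    (fun x y z => by
      obtain ⟨x, rfl⟩ := e.rightHom_surjective x
      obtain ⟨y, rfl⟩ := e.rightHom_surjective y
      obtain ⟨z, rfl⟩ := e.rightHom_surjective z
      refine Subtype.ext ?_
      simp only [conj, ← map_mul, ← map_inv, Subgroup.coe_mul, commMap_rightHom he]
      simp only [comm]
      group)
    (fun x y z => by
      obtain ⟨x, rfl⟩ := e.rightHom_surjective x
      obtain ⟨y, rfl⟩ := e.rightHom_surjective y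
      obtain ⟨z, rfl⟩ := e.rightHom_surjective z
      refine Subtype.ext ?_
      simp only [conj, ← map_mul, ← map_inv, Subgroup.coe_mul, commMap_rightHom he]
      simp only [comm]
      group)
    (fun x => by
      obtain ⟨x, rfl⟩ := e.rightHom_surjective x
      refine Subtype.ext ?_
      rw [commMap_rightHom he]
      simp [comm])

theorem extCommHom_wedge (e : GroupExtension N G F) (he : IsCentral e) (g h : G) :
    (extCommHom e he (wedge (e.rightHom g) (e.rightHom h)) : G) = comm g h := by
  rw [extCommHom, ExtSquare.lift_wedge, commMap_rightHom he]

theorem rightHom_extCommHom (e : GroupExtension N G F) (he : IsCentral e) (w : ExtSquare F) :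
    e.rightHom (extCommHom e he w) = commHom F w := by
  have : e.rightHom.comp ((commutator G).subtype.comp (extCommHom e he)) =
      (commutator F).subtype.comp (commHom F) := by
    refine ExtSquare.hom_ext fun x y => ?_
    obtain ⟨x, rfl⟩ := e.rightHom_surjective x
    obtain ⟨y, rfl⟩ := e.rightHom_surjective y
    simp [extCommHom_wedge, map_comm]
  exact DFunLike.congr_fun this w

theorem extCommHom_mem (e : GroupExtension N G F) (he : IsCentral e) (w : M F) :
    (extCommHom e he w : G) ∈ e.inl.range := by
  have h : commHom F w = 1 := w.2
  rw [e.range_inl_eq_ker_rightHom, MonoidHom.mem_ker, rightHom_extCommHom, h]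
  rfl

/-- The homomorphism `θ : M(F) → N`, `∏ (xᵢ ∧ yᵢ) ↦ ∏ [gᵢ, hᵢ]`, of a central extension `e` of `N`
by `F`, where `gᵢ` and `hᵢ` are lifts of `xᵢ` and `yᵢ` and `N` is identified with its image. -/
noncomputable def theta (e : GroupExtension N G F) (he : IsCentral e) : M F →* N :=
  (MonoidHom.ofInjective e.inl_injective).symm.toMonoidHom.comp
    ((((commutator G).subtype.comp (extCommHom e he)).comp (M F).subtype).codRestrict
      e.inl.range (extCommHom_mem e he))

theorem inl_theta (e : GroupExtension N G F) (he : IsCentral e) (w : M F) :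
    e.inl (theta e he w) = extCommHom e he w :=
  MonoidHom.apply_ofInjective_symm e.inl_injective ⟨_, extCommHom_mem e he w⟩

theorem theta_eq_one (e : GroupExtension N G F) (he : IsCentral e) (hcp : IsCP e) (w : M F)
    (hw : (w : ExtSquare F) ∈ M₀ F) : theta e he w = 1 := by
  apply e.inl_injective
  rw [inl_theta, map_one]
  suffices M₀ F ≤ ((commutator G).subtype.comp (extCommHom e he)).ker from this hw
  rw [M₀, Subgroup.closure_le]
  rintro _ ⟨x, y, hxy, rfl⟩
  obtain ⟨g, h, rfl, rfl, hgh⟩ := hcp x y ((comm_eq_one_iff x y).mp hxy)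
  rw [SetLike.mem_coe, MonoidHom.mem_ker]
  change (extCommHom e he _ : G) = 1
  rw [extCommHom_wedge, (comm_eq_one_iff g h).mpr hgh]

/-- The homomorphism `B₀(F) → N` induced by `theta` for a central CP extension of `N` by `F`. -/
noncomputable def thetaTilde (e : GroupExtension N G F) (he : IsCentral e) (hcp : IsCP e) :
    B₀ F →* N :=
  QuotientGroup.lift _ (theta e he) fun w hw => theta_eq_one e he hcp w hw

end Extensions

/-- A central CP extension `1 → N → G → F → 1` whose factor group `F` is isomorphic to `Q`. -/
structure CentralCPExtension (Q : Type u) [Group Q] : Type (u + 1) where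
  /-- the kernel -/
  N : Type u
  /-- the extension group -/
  G : Type u
  /-- the factor group -/
  F : Type u
  [groupN : Group N]
  [groupG : Group G]
  [groupF : Group F]
  /-- the short exact sequence -/
  ext : GroupExtension N G F
  central : IsCentral ext
  cp : IsCP ext
  factor_iso : Nonempty (F ≃* Q)

attribute [instance] CentralCPExtension.groupN CentralCPExtension.groupG
  CentralCPExtension.groupF

/-- Isoclinism as an equivalence relation on central CP extensions with factor group isomorphic
to `Q`. -/
instance isoclinismSetoid (Q : Type u) [Group Q] : Setoid (CentralCPExtension Q) where
  r e₁ e₂ := Isoclinic e₁.ext e₂.ext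
  iseqv :=
    { refl := fun _ => ⟨MulEquiv.refl _, MulEquiv.refl _, fun _ _ => rfl⟩
      symm := by
        rintro e₁ e₂ ⟨η, ξ, h⟩
        refine ⟨η.symm, ξ.symm, fun x y => ?_⟩
        rw [MulEquiv.symm_apply_eq, h, MulEquiv.apply_symm_apply, MulEquiv.apply_symm_apply]
      trans := by
        rintro e₁ e₂ e₃ ⟨η, ξ, h⟩ ⟨η', ξ', h'⟩
        refine ⟨η.trans η', ξ.trans ξ', fun x y => ?_⟩
        simp [h, h'] }

/-- The set of isoclinism classes of central CP extensions with factor group isomorphic to `Q`. -/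
abbrev IsoclinismClasses (Q : Type u) [Group Q] : Type (u + 1) :=
  Quotient (isoclinismSetoid Q)

/-- The set of orbits of `Aut Q` on the subgroups of `B₀(Q)`. -/
abbrev SubgroupOrbits (Q : Type u) [Group Q] : Type u :=
  MulAction.orbitRel.Quotient (MulAut Q) (Subgroup (B₀ Q))

end CPExt

-- For a central extension `e` the commutator map induces a surjection `F ∧ F → G'` (`extCommHom`),
-- so `G'` together with the map `c` amounts to its kernel. Hence an isomorphism `η` of factor
-- groups extends to an isoclinism exactly when `η ∧ η` matches the two kernels. Such a kernel lies
-- in `M(F)`, because `G → F` sends commutators to commutators, and it contains `M₀(F)` by the CP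
-- property; it is therefore the same datum as the kernel of `thetaTilde` in `B₀(F)`. So isoclinic
-- means that some `B₀(η)` carries one kernel to the other (`isoclinic_iff`). After identifying the
-- factor groups with `Q`, this is equality of `Aut Q`-orbits, which gives well-definedness and
-- injectivity.
--
-- For surjectivity, let `π : Γ → Q` be onto with `Γ` free, and let `V` consist of the commutators
-- of those elements of `Γ ∧ Γ` that map into the preimage of `U` in `Q ∧ Q`. Then `Γ / V → Q` is a
-- central CP extension. Its kernel is exactly `U` because `M(Γ) = 1`, so that an element of `Γ ∧ Γ`
-- is determined by its commutator (`ker_thetaTilde_relationExtension`).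
--
-- The vanishing `M_freeGroup` is proved by reduction to finite rank and induction on the rank. When
-- a cyclic factor `S` is added to `G` to form `Γ`, an explicit group containing `Γ ∧ Γ`, `S` and
-- `G` receives a homomorphism `Ψ` from `Γ`. Modulo the subgroup on which `Ψ` recovers an element of
-- `Γ ∧ Γ` from its commutator, everything comes from `G ∧ G`. An element of `M(Γ)` therefore lies
-- in that subgroup, and it is trivial because its commutator is.

universe v

namespace CPExt

/-! ### The crossed module `Q ∧ Q → Q` and identities for left commutators -/

section ConjugationAction

variable {Q : Type u} [Group Q]

/-- The action of `Q` on `Q ∧ Q` induced by (left) conjugation. -/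
instance : MulDistribMulAction Q (ExtSquare Q) where
  smul g w := ExtSquare.map (MulAut.conj g).toMonoidHom w
  one_smul w := by
    have h : ExtSquare.map (MulAut.conj (1 : Q)).toMonoidHom = MonoidHom.id (ExtSquare Q) :=
      ExtSquare.hom_ext fun x y => by simp
    exact DFunLike.congr_fun h w
  mul_smul g g' w := by
    have h : ExtSquare.map (MulAut.conj (g * g')).toMonoidHom =
        (ExtSquare.map (MulAut.conj g).toMonoidHom).comp
          (ExtSquare.map (MulAut.conj g').toMonoidHom) :=
      ExtSquare.hom_ext fun x y => by simp
    exact DFunLike.congr_fun h w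
  smul_mul g w w' := map_mul (ExtSquare.map (MulAut.conj g).toMonoidHom) w w'
  smul_one g := map_one (ExtSquare.map (MulAut.conj g).toMonoidHom)

theorem smul_def (g : Q) (w : ExtSquare Q) :
    g • w = ExtSquare.map (MulAut.conj g).toMonoidHom w := rfl

theorem smul_wedge (g x y : Q) :
    g • wedge x y = wedge (g * x * g⁻¹) (g * y * g⁻¹) := by
  simp [smul_def]

theorem commHom_smul (g : Q) (w : ExtSquare Q) :
    (commHom Q (g • w) : Q) = g * commHom Q w * g⁻¹ := by
  rw [smul_def, commHom_map]
  rfl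

/-- The Peiffer identity of the crossed module `Q ∧ Q → Q`. -/
theorem commHom_smul_mul (p w : ExtSquare Q) : (commHom Q p : Q) • w * p = p * w := by
  have h : ExtSquare.map (MulAut.conj (commHom Q p : Q)).toMonoidHom =
      (MulAut.conj p).toMonoidHom := by
    refine ExtSquare.hom_ext fun x y => ?_
    have := wedge_mul_eq p (commHom Q p * x * (commHom Q p : Q)⁻¹)
      (commHom Q p * y * (commHom Q p : Q)⁻¹)
    have hc : ∀ z : Q, conj (commHom Q p * z * (commHom Q p : Q)⁻¹) (commHom Q p) = z := by
      intro z; simp only [conj]; group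
    rw [hc, hc] at this
    simp [← this]
  rw [smul_def, h]
  simp

/-- The element of `Q ∧ Q` mapped to `x * y * x⁻¹ * y⁻¹` by the commutator homomorphism. -/
def leftWedge (x y : Q) : ExtSquare Q := wedge x⁻¹ y⁻¹

theorem wedge_eq_leftWedge (x y : Q) : wedge x y = leftWedge x⁻¹ y⁻¹ := by
  simp [leftWedge]

theorem commHom_leftWedge (x y : Q) : (commHom Q (leftWedge x y) : Q) = x * y * x⁻¹ * y⁻¹ := by
  simp [leftWedge, comm]

theorem map_leftWedge {R : Type u} [Group R] (f : Q →* R) (x y : Q) :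
    ExtSquare.map f (leftWedge x y) = leftWedge (f x) (f y) := by
  simp [leftWedge]

theorem smul_leftWedge (g x y : Q) :
    g • leftWedge x y = leftWedge (g * x * g⁻¹) (g * y * g⁻¹) := by
  simp [leftWedge, smul_wedge, mul_assoc]

theorem leftWedge_mul_left (x y z : Q) :
    leftWedge (x * y) z = x • leftWedge y z * leftWedge x z := by
  rw [leftWedge, mul_inv_rev, wedge_mul_left, leftWedge, smul_wedge]
  simp [conj, leftWedge]

theorem leftWedge_mul_right (x y z : Q) :
    leftWedge x (y * z) = leftWedge x y * y • leftWedge x z := by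
  rw [leftWedge, mul_inv_rev, wedge_mul_right, leftWedge, leftWedge, smul_wedge]
  simp [conj]

theorem leftWedge_self (x : Q) : leftWedge x x = 1 := wedge_self _

theorem leftWedge_one_left (x : Q) : leftWedge 1 x = 1 := by
  simpa using leftWedge_mul_left 1 1 x

theorem leftWedge_one_right (x : Q) : leftWedge x 1 = 1 := by
  simpa using leftWedge_mul_right x 1 1

theorem leftWedge_inv_left (x y : Q) : leftWedge x⁻¹ y = x⁻¹ • (leftWedge x y)⁻¹ := by
  have h := leftWedge_mul_left x⁻¹ x y
  rw [inv_mul_cancel, leftWedge_one_left] at h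
  rw [smul_inv', eq_comm, inv_eq_iff_mul_eq_one]
  exact h.symm

/-- Expand `leftWedge (x * y) (x * y) = 1` in both arguments; the diagonal terms vanish, and the
rest is `x` acting on the product of the two mixed terms. -/
theorem leftWedge_swap (x y : Q) : leftWedge y x = (leftWedge x y)⁻¹ := by
  have h := leftWedge_self (x * y)
  rw [leftWedge_mul_left, leftWedge_mul_right, leftWedge_mul_right, leftWedge_self,
    leftWedge_self, smul_one, mul_one, one_mul, ← smul_mul'] at h
  exact eq_inv_of_mul_eq_one_left (MulAction.injective x (h.trans (smul_one x).symm))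

theorem leftWedge_zpow_left {x y : Q} (h : leftWedge x y = 1) (n : ℤ) :
    leftWedge (x ^ n) y = 1 := by
  induction n using Int.induction_on with
  | zero => rw [zpow_zero, leftWedge_one_left]
  | succ n ih => rw [zpow_add_one, leftWedge_mul_left, h, ih, smul_one, mul_one]
  | pred n ih =>
    rw [zpow_sub_one, leftWedge_mul_left, leftWedge_inv_left, h, ih, inv_one, smul_one, smul_one,
      mul_one]

theorem leftWedge_zpow_zpow (x : Q) (m n : ℤ) : leftWedge (x ^ m) (x ^ n) = 1 := by
  apply leftWedge_zpow_left
  rw [leftWedge_swap, leftWedge_zpow_left (leftWedge_self x), inv_one]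

/-- This is the Peiffer identity for `leftWedge x y`, whose image is the commutator taking `y * x`
to `x * y`. -/
theorem leftWedge_commHom_smul_mul (x y : Q) (w : ExtSquare Q) :
    (x * y) • w * leftWedge x y = leftWedge x y * (y * x) • w := by
  rw [← commHom_smul_mul (leftWedge x y), commHom_leftWedge, smul_smul]
  congr 2
  group

/-- The equation `e` expands `leftWedge g (k * h)` in two ways, writing `k * h` also as `h * (h⁻¹ *
k * h)`; the Peiffer identity then moves `leftWedge g h` to the front. The formula turns triviality
of wedges with `k` into triviality of the action of `k`. -/
theorem leftWedge_commutator_left (g h k : Q) :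
    leftWedge (g * h * g⁻¹ * h⁻¹) k = leftWedge g h * k • (leftWedge g h)⁻¹ := by
  have e : leftWedge g k * k • leftWedge g h =
      leftWedge g h * h • leftWedge g (h⁻¹ * k * h) := by
    rw [← leftWedge_mul_right, ← leftWedge_mul_right]
    congr 1
    group
  have e2 : g * h * g⁻¹ * h⁻¹ = g * (h * g⁻¹ * h⁻¹) := by group
  have e3 : leftWedge (h * g⁻¹ * h⁻¹) k = h • leftWedge g⁻¹ (h⁻¹ * k * h) := by
    rw [smul_leftWedge]
    congr 1
    group
  have e4 := leftWedge_commHom_smul_mul g h (g⁻¹ • (leftWedge g (h⁻¹ * k * h))⁻¹)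
  rw [smul_smul, smul_smul, mul_inv_cancel_right] at e4
  rw [e2, leftWedge_mul_left, e3, leftWedge_inv_left, smul_smul, smul_smul,
    eq_mul_inv_of_mul_eq e4, mul_assoc, mul_assoc]
  congr 1
  rw [smul_inv', smul_inv', inv_mul_eq_iff_eq_mul, inv_mul_eq_iff_eq_mul, ← mul_assoc,
    eq_mul_inv_iff_mul_eq, e]

end ConjugationAction

/-! ### A group containing `Γ ∧ Γ`, `S` and `G` with prescribed commutators -/

section CrossedExtension

variable {Γ G : Type u} {S : Type v} [Group Γ] [Group S] [Group G]

/-- For homomorphisms `s : S → Γ` and `i : G → Γ`, the group of formal products `k * s a * i g`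
with `k ∈ Γ ∧ Γ`, `a ∈ S` and `g ∈ G`, in which the commutator of `i g` and `s a` is
`leftWedge (i g) (s a)`. -/
@[ext]
structure WedgeExtension (s : S →* Γ) (i : G →* Γ) where
  wedgePart : ExtSquare Γ
  left : S
  right : G

namespace WedgeExtension

variable {s : S →* Γ} {i : G →* Γ}

/-- The rule results from collecting `(k * s a * i g) * (k' * s a' * i g')`: `k'` moves left past `s
a * i g`, and moving `i g` past `s a'` creates `leftWedge (i g) (s a')`, which then moves left past
`s a`. -/
instance : Mul (WedgeExtension s i) where
  mul x y := ⟨x.wedgePart * ((s x.left * i x.right) • y.wedgePart *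
      s x.left • leftWedge (i x.right) (s y.left)), x.left * y.left, x.right * y.right⟩

instance : One (WedgeExtension s i) where
  one := ⟨1, 1, 1⟩

theorem mk_mul_mk (k k' : ExtSquare Γ) (a a' : S) (g g' : G) :
    (⟨k, a, g⟩ * ⟨k', a', g'⟩ : WedgeExtension s i) =
      ⟨k * ((s a * i g) • k' * s a • leftWedge (i g) (s a')), a * a', g * g'⟩ := rfl

theorem one_def : (1 : WedgeExtension s i) = ⟨1, 1, 1⟩ := rfl

instance : Inv (WedgeExtension s i) where
  inv x := ⟨1, 1, x.right⁻¹⟩ * (⟨1, x.left⁻¹, 1⟩ * ⟨x.wedgePart⁻¹, 1, 1⟩)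

theorem inv_mk (k : ExtSquare Γ) (a : S) (g : G) :
    (⟨k, a, g⟩ : WedgeExtension s i)⁻¹ = ⟨1, 1, g⁻¹⟩ * (⟨1, a⁻¹, 1⟩ * ⟨k⁻¹, 1, 1⟩) := rfl

theorem mul_assoc' (x y z : WedgeExtension s i) : x * y * z = x * (y * z) := by
  obtain ⟨k, a, g⟩ := x
  obtain ⟨k', a', g'⟩ := y
  obtain ⟨k'', a'', g''⟩ := z
  -- Associativity reduces to the Peiffer identity: the two bracketings collect `i g` and `s a'` in
  -- opposite orders.
  have h := fun w => leftWedge_commHom_smul_mul (i g) (s a') w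
  have h' : ∀ w v, leftWedge (i g) (s a') * ((s a' * i g) • w * v) =
      (i g * s a') • w * (leftWedge (i g) (s a') * v) := by
    intro w v
    rw [← mul_assoc, ← mul_assoc, h]
  simp only [mk_mul_mk, WedgeExtension.mk.injEq, mul_assoc, and_true]
  rw [map_mul, map_mul, map_mul, leftWedge_mul_left, leftWedge_mul_right]
  congr 1
  simp only [smul_mul', smul_smul, mul_assoc]
  congr 1
  have := congrArg (s a • ·) (h' (i g' • k'' * leftWedge (i g') (s a''))
    (s a' • leftWedge (i g) (s a'')))
  simpa only [smul_mul', smul_smul, mul_assoc] using this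

instance : Group (WedgeExtension s i) :=
  Group.ofLeftAxioms mul_assoc'
    (fun x => by
      obtain ⟨k, a, g⟩ := x
      rw [one_def, mk_mul_mk]
      simp [leftWedge_one_left])
    (fun x => by
      obtain ⟨k, a, g⟩ := x
      rw [inv_mk, one_def, mul_assoc', mul_assoc']
      simp [mk_mul_mk, leftWedge_one_left, leftWedge_one_right])

variable (s i)

/-- The inclusion of `Γ ∧ Γ`. -/
def ofWedge : ExtSquare Γ →* WedgeExtension s i where
  toFun w := ⟨w, 1, 1⟩
  map_one' := rfl
  map_mul' w v := by simp [mk_mul_mk, leftWedge_one_left]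

/-- The inclusion of the left factor `S`. -/
def ofLeft : S →* WedgeExtension s i where
  toFun a := ⟨1, a, 1⟩
  map_one' := rfl
  map_mul' a b := by simp [mk_mul_mk, leftWedge_one_left]

/-- The inclusion of the right factor `G`. -/
def ofRight : G →* WedgeExtension s i where
  toFun g := ⟨1, 1, g⟩
  map_one' := rfl
  map_mul' g h := by simp [mk_mul_mk, leftWedge_one_right]

theorem ofWedge_injective : Function.Injective (ofWedge s i) :=
  fun _ _ h => congrArg wedgePart h

theorem ofLeft_mul_ofWedge (a : S) (w : ExtSquare Γ) :
    ofLeft s i a * ofWedge s i w = ofWedge s i (s a • w) * ofLeft s i a := by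
  simp [ofLeft, ofWedge, mk_mul_mk, leftWedge_one_left]

theorem ofRight_mul_ofWedge (g : G) (w : ExtSquare Γ) :
    ofRight s i g * ofWedge s i w = ofWedge s i (i g • w) * ofRight s i g := by
  simp [ofRight, ofWedge, mk_mul_mk, leftWedge_one_right]

theorem ofRight_mul_ofLeft (g : G) (a : S) :
    ofRight s i g * ofLeft s i a =
      ofWedge s i (leftWedge (i g) (s a)) * (ofLeft s i a * ofRight s i g) := by
  simp [ofRight, ofWedge, ofLeft, mk_mul_mk, leftWedge_one_left]

end WedgeExtension

end CrossedExtension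

/-! ### Triviality of `M(Γ)` when `Γ` is generated by `S` and a retract `G` -/

section FreeProduct

variable {Γ G : Type u} {S : Type v} [Group Γ] [Group S] [Group G]

theorem induction_of_range_sup_range {s : S →* Γ} {i : G →* Γ} (hsi : s.range ⊔ i.range = ⊤)
    {p : Γ → Prop} (left : ∀ a, p (s a)) (right : ∀ g, p (i g))
    (mul : ∀ γ δ, p γ → p δ → p (γ * δ)) (γ : Γ) : p γ := by
  have h : γ ∈ Subgroup.closure ((s.range : Set Γ) ∪ i.range) := by
    rw [Subgroup.closure_union, Subgroup.closure_eq, Subgroup.closure_eq, hsi]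
    exact Subgroup.mem_top γ
  induction h using Subgroup.closure_induction'' with
  | mem x hx => rcases hx with ⟨a, rfl⟩ | ⟨g, rfl⟩; exacts [left a, right g]
  | inv_mem x hx =>
    rcases hx with ⟨a, rfl⟩ | ⟨g, rfl⟩
    · rw [← map_inv]; exact left _
    · rw [← map_inv]; exact right _
  | one => rw [← map_one s]; exact left 1
  | mul x y _ _ hx hy => exact mul x y hx hy

/-- The elements of `Γ ∧ Γ` whose image in `WedgeExtension s i` agrees with that of their
commutator under `Ψ`. -/
def wedgeEqLocus {s : S →* Γ} {i : G →* Γ} (Ψ : Γ →* WedgeExtension s i) :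
    Subgroup (ExtSquare Γ) :=
  (WedgeExtension.ofWedge s i).eqLocus (Ψ.comp ((commutator Γ).subtype.comp (commHom Γ)))

variable {s : S →* Γ} {i : G →* Γ} {Ψ : Γ →* WedgeExtension s i}

theorem mem_wedgeEqLocus {w : ExtSquare Γ} :
    w ∈ wedgeEqLocus Ψ ↔ WedgeExtension.ofWedge s i w = Ψ (commHom Γ w) := Iff.rfl

theorem map_mul_ofWedge (hsi : s.range ⊔ i.range = ⊤)
    (hs : ∀ a, Ψ (s a) = WedgeExtension.ofLeft s i a)
    (hi : ∀ g, Ψ (i g) = WedgeExtension.ofRight s i g) (γ : Γ) :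
    ∀ w, Ψ γ * WedgeExtension.ofWedge s i w = WedgeExtension.ofWedge s i (γ • w) * Ψ γ := by
  refine induction_of_range_sup_range hsi
    (p := fun γ => ∀ w, Ψ γ * WedgeExtension.ofWedge s i w =
      WedgeExtension.ofWedge s i (γ • w) * Ψ γ) ?_ ?_ ?_ γ
  · intro a w
    rw [hs, WedgeExtension.ofLeft_mul_ofWedge]
  · intro g w
    rw [hi, WedgeExtension.ofRight_mul_ofWedge]
  · intro γ δ h₁ h₂ w
    rw [map_mul, mul_assoc, h₂, ← mul_assoc, h₁, mul_assoc, smul_smul]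

/-- Both homomorphisms compared by the locus are equivariant: conjugation by `Ψ γ` acts on the copy
of `Γ ∧ Γ` as `γ` does. -/
theorem smul_mem_wedgeEqLocus (hsi : s.range ⊔ i.range = ⊤)
    (hs : ∀ a, Ψ (s a) = WedgeExtension.ofLeft s i a)
    (hi : ∀ g, Ψ (i g) = WedgeExtension.ofRight s i g) (γ : Γ) {w : ExtSquare Γ}
    (hw : w ∈ wedgeEqLocus Ψ) : γ • w ∈ wedgeEqLocus Ψ := by
  rw [mem_wedgeEqLocus] at hw ⊢
  rw [commHom_smul, map_mul, map_mul, ← hw, map_mul_ofWedge hsi hs hi, map_inv,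
    mul_inv_cancel_right]

theorem leftWedge_mem_wedgeEqLocus
    (hs : ∀ a, Ψ (s a) = WedgeExtension.ofLeft s i a)
    (hi : ∀ g, Ψ (i g) = WedgeExtension.ofRight s i g) (g : G) (a : S) :
    leftWedge (i g) (s a) ∈ wedgeEqLocus Ψ := by
  rw [mem_wedgeEqLocus, commHom_leftWedge, map_mul, map_mul, map_mul, map_inv, map_inv, hs, hi,
    WedgeExtension.ofRight_mul_ofLeft]
  group

/-- Induct on `δ`: wedges within `S` vanish, wedges of `G` with `S` lie in the locus by construction
of the extension, and the product rule stays inside because the locus is stable under `Γ`. -/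
theorem leftWedge_left_mem_wedgeEqLocus (hsi : s.range ⊔ i.range = ⊤)
    (hs : ∀ a, Ψ (s a) = WedgeExtension.ofLeft s i a)
    (hi : ∀ g, Ψ (i g) = WedgeExtension.ofRight s i g)
    (hS : ∀ a b, leftWedge (s a) (s b) = 1) (δ : Γ) (a : S) :
    leftWedge δ (s a) ∈ wedgeEqLocus Ψ := by
  refine induction_of_range_sup_range hsi
    (p := fun δ => leftWedge δ (s a) ∈ wedgeEqLocus Ψ) ?_ ?_ ?_ δ
  · intro b
    rw [hS]
    exact one_mem _
  · intro g
    exact leftWedge_mem_wedgeEqLocus hs hi g a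
  · intro γ δ h₁ h₂
    rw [leftWedge_mul_left]
    exact mul_mem (smul_mem_wedgeEqLocus hsi hs hi γ h₂) h₁

theorem wedgeEqLocus_normal (hsi : s.range ⊔ i.range = ⊤)
    (hs : ∀ a, Ψ (s a) = WedgeExtension.ofLeft s i a)
    (hi : ∀ g, Ψ (i g) = WedgeExtension.ofRight s i g) : (wedgeEqLocus Ψ).Normal where
  conj_mem w hw p := by
    -- Conjugation by `p` is the action of its commutator, so stability under `Γ` gives normality.
    rw [← commHom_smul_mul p w, mul_inv_cancel_right]
    exact smul_mem_wedgeEqLocus hsi hs hi _ hw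

theorem mk_smul_congr (hsi : s.range ⊔ i.range = ⊤)
    (hs : ∀ a, Ψ (s a) = WedgeExtension.ofLeft s i a)
    (hi : ∀ g, Ψ (i g) = WedgeExtension.ofRight s i g) (γ : Γ) {w v : ExtSquare Γ}
    (h : (w : ExtSquare Γ ⧸ wedgeEqLocus Ψ) = v) :
    ((γ • w : ExtSquare Γ) : ExtSquare Γ ⧸ wedgeEqLocus Ψ) = (γ • v : ExtSquare Γ) := by
  rw [QuotientGroup.eq] at h ⊢
  rw [← smul_inv', ← smul_mul']
  exact smul_mem_wedgeEqLocus hsi hs hi γ h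

theorem mk_left_smul (hsi : s.range ⊔ i.range = ⊤)
    (hs : ∀ a, Ψ (s a) = WedgeExtension.ofLeft s i a)
    (hi : ∀ g, Ψ (i g) = WedgeExtension.ofRight s i g)
    (hS : ∀ a b, leftWedge (s a) (s b) = 1) (a : S) (w : ExtSquare Γ) :
    ((s a • w : ExtSquare Γ) : ExtSquare Γ ⧸ wedgeEqLocus Ψ) = w := by
  have := wedgeEqLocus_normal hsi hs hi
  have h : (QuotientGroup.mk' (wedgeEqLocus Ψ)).comp
      (ExtSquare.map (MulAut.conj (s a)).toMonoidHom) = QuotientGroup.mk' (wedgeEqLocus Ψ) := by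
    refine ExtSquare.hom_ext fun x y => ?_
    -- The wedge of `x⁻¹ * y⁻¹ * x * y` with `s a` lies in the locus and equals `wedge x y` times
    -- the inverse of its translate by `s a`.
    have h := leftWedge_left_mem_wedgeEqLocus hsi hs hi hS (x⁻¹ * y⁻¹ * x⁻¹⁻¹ * y⁻¹⁻¹) a
    rw [leftWedge_commutator_left, ← wedge_eq_leftWedge, smul_inv', ← QuotientGroup.eq_one_iff,
      QuotientGroup.mk_mul, QuotientGroup.mk_inv, mul_inv_eq_one] at h
    exact h.symm
  exact DFunLike.congr_fun h w

variable {ρ : Γ →* G}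

theorem mk_retraction_smul (hsi : s.range ⊔ i.range = ⊤)
    (hs : ∀ a, Ψ (s a) = WedgeExtension.ofLeft s i a)
    (hi : ∀ g, Ψ (i g) = WedgeExtension.ofRight s i g)
    (hS : ∀ a b, leftWedge (s a) (s b) = 1) (hρs : ∀ a, ρ (s a) = 1) (hρi : ∀ g, ρ (i g) = g)
    (γ : Γ) : ∀ w : ExtSquare Γ,
    ((γ • w : ExtSquare Γ) : ExtSquare Γ ⧸ wedgeEqLocus Ψ) = (i (ρ γ) • w : ExtSquare Γ) := by
  refine induction_of_range_sup_range hsi (p := fun γ => ∀ w : ExtSquare Γ,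
    ((γ • w : ExtSquare Γ) : ExtSquare Γ ⧸ wedgeEqLocus Ψ) = (i (ρ γ) • w : ExtSquare Γ))
    ?_ ?_ ?_ γ
  · intro a w
    rw [hρs, map_one, one_smul, mk_left_smul hsi hs hi hS]
  · intro g w
    rw [hρi]
  · intro γ δ h₁ h₂ w
    rw [← smul_smul, mk_smul_congr hsi hs hi γ (h₂ w), h₁, smul_smul, map_mul, map_mul]

theorem mk_leftWedge_retraction (hsi : s.range ⊔ i.range = ⊤)
    (hs : ∀ a, Ψ (s a) = WedgeExtension.ofLeft s i a)
    (hi : ∀ g, Ψ (i g) = WedgeExtension.ofRight s i g)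
    (hS : ∀ a b, leftWedge (s a) (s b) = 1) (hρs : ∀ a, ρ (s a) = 1) (hρi : ∀ g, ρ (i g) = g)
    (γ δ : Γ) : (leftWedge γ δ : ExtSquare Γ ⧸ wedgeEqLocus Ψ) =
      leftWedge (i (ρ γ)) (i (ρ δ)) := by
  have := wedgeEqLocus_normal hsi hs hi
  have hδ := leftWedge_left_mem_wedgeEqLocus hsi hs hi hS
  refine induction_of_range_sup_range hsi (p := fun γ =>
    (leftWedge γ δ : ExtSquare Γ ⧸ wedgeEqLocus Ψ) = leftWedge (i (ρ γ)) (i (ρ δ))) ?_ ?_ ?_ γ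
  · intro a
    rw [hρs, map_one, leftWedge_one_left, leftWedge_swap, QuotientGroup.mk_one,
      QuotientGroup.eq_one_iff]
    exact inv_mem (hδ δ a)
  · intro g
    refine induction_of_range_sup_range hsi (p := fun δ =>
      (leftWedge (i g) δ : ExtSquare Γ ⧸ wedgeEqLocus Ψ) = leftWedge (i (ρ (i g))) (i (ρ δ)))
      ?_ ?_ ?_ δ
    · intro a
      rw [hρs, map_one, leftWedge_one_right, QuotientGroup.mk_one, QuotientGroup.eq_one_iff]
      exact hδ _ a
    · intro h
      rw [hρi, hρi]
    · intro δ ε h₁ h₂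
      rw [leftWedge_mul_right, map_mul, map_mul, leftWedge_mul_right, QuotientGroup.mk_mul,
        QuotientGroup.mk_mul, h₁, mk_smul_congr hsi hs hi δ h₂,
        mk_retraction_smul hsi hs hi hS hρs hρi]
  · intro γ ε h₁ h₂
    rw [leftWedge_mul_left, map_mul, map_mul, leftWedge_mul_left, QuotientGroup.mk_mul,
      QuotientGroup.mk_mul, h₁, mk_smul_congr hsi hs hi γ h₂,
      mk_retraction_smul hsi hs hi hS hρs hρi]

/-- Modulo the locus, `Γ ∧ Γ` factors through `ρ`, and `ρ` sends `M(Γ)` into `M(G) = 1`; hence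
`M(Γ)` lies in the locus. There `w` is recovered in the extension from its commutator, which is
trivial. -/
theorem M_eq_bot_of_retraction (hsi : s.range ⊔ i.range = ⊤)
    (hs : ∀ a, Ψ (s a) = WedgeExtension.ofLeft s i a)
    (hi : ∀ g, Ψ (i g) = WedgeExtension.ofRight s i g)
    (hS : ∀ a b, leftWedge (s a) (s b) = 1) (hρs : ∀ a, ρ (s a) = 1) (hρi : ∀ g, ρ (i g) = g)
    (hG : M G = ⊥) : M Γ = ⊥ := by
  have := wedgeEqLocus_normal hsi hs hi
  have h : QuotientGroup.mk' (wedgeEqLocus Ψ) =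
      (QuotientGroup.mk' (wedgeEqLocus Ψ)).comp ((ExtSquare.map i).comp (ExtSquare.map ρ)) := by
    refine ExtSquare.hom_ext fun x y => ?_
    rw [wedge_eq_leftWedge, MonoidHom.comp_apply, MonoidHom.comp_apply, map_leftWedge,
      map_leftWedge]
    exact mk_leftWedge_retraction hsi hs hi hS hρs hρi _ _
  rw [eq_bot_iff]
  intro w hw
  have h₁ : ExtSquare.map ρ w = 1 := by
    rw [← Subgroup.mem_bot, ← hG]
    exact map_mem_M ρ hw
  have h₂ := DFunLike.congr_fun h w
  rw [MonoidHom.comp_apply, MonoidHom.comp_apply, h₁, map_one, map_one, QuotientGroup.mk'_apply,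
    QuotientGroup.eq_one_iff, mem_wedgeEqLocus, show commHom Γ w = 1 from hw, Subgroup.coe_one,
    map_one] at h₂
  exact WedgeExtension.ofWedge_injective s i (h₂.trans (map_one _).symm)

end FreeProduct

/-! ### The Schur multiplier of a free group -/

section FreeGroup

theorem M_eq_bot_of_mulEquiv {Q R : Type u} [Group Q] [Group R] (f : Q ≃* R) (h : M Q = ⊥) :
    M R = ⊥ := by
  rw [eq_bot_iff]
  intro w hw
  have h₁ : ExtSquare.map f.symm.toMonoidHom w = 1 := by
    rw [← Subgroup.mem_bot, ← h]
    exact map_mem_M _ hw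
  have h₂ : (ExtSquare.map f.toMonoidHom).comp (ExtSquare.map f.symm.toMonoidHom) =
      MonoidHom.id (ExtSquare R) := ExtSquare.hom_ext fun x y => by simp
  have h₃ := DFunLike.congr_fun h₂ w
  rw [MonoidHom.comp_apply, h₁, map_one] at h₃
  exact h₃.symm

theorem M_freeGroup_option {X : Type u} (h : M (FreeGroup X) = ⊥) :
    M (FreeGroup (Option X)) = ⊥ := by
  -- The generator `none` spans the cyclic factor `S`, and the others span `G`. Freeness provides
  -- both `Ψ` and the retraction `ρ`, which kills `none`.
  let s : Multiplicative ℤ →* FreeGroup (Option X) := zpowersHom _ (FreeGroup.of none)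
  let i : FreeGroup X →* FreeGroup (Option X) := FreeGroup.map some
  let Ψ : FreeGroup (Option X) →* WedgeExtension s i := FreeGroup.lift fun o =>
    o.elim (WedgeExtension.ofLeft s i (Multiplicative.ofAdd 1))
      fun x => WedgeExtension.ofRight s i (FreeGroup.of x)
  let ρ : FreeGroup (Option X) →* FreeGroup X := FreeGroup.lift fun o => o.elim 1 FreeGroup.of
  have hs : Ψ.comp s = WedgeExtension.ofLeft s i := by
    refine MonoidHom.ext_mint ?_
    simp [Ψ, s]
  have hi : Ψ.comp i = WedgeExtension.ofRight s i := by
    ext x : 1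
    simp [Ψ, i]
  have hρs : ρ.comp s = 1 := by
    refine MonoidHom.ext_mint ?_
    simp [ρ, s]
  have hρi : ρ.comp i = MonoidHom.id _ := by
    ext x : 1
    simp [ρ, i]
  have hsi : s.range ⊔ i.range = ⊤ := by
    rw [eq_top_iff, ← FreeGroup.closure_range_of, Subgroup.closure_le]
    rintro _ ⟨_ | x, rfl⟩
    · exact (le_sup_left : s.range ≤ _) ⟨Multiplicative.ofAdd 1, by simp [s]⟩
    · exact (le_sup_right : i.range ≤ _) ⟨FreeGroup.of x, by simp [i]⟩
  have hS : ∀ a b, leftWedge (s a) (s b) = 1 := by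
    intro a b
    exact leftWedge_zpow_zpow _ a.toAdd b.toAdd
  exact M_eq_bot_of_retraction (Ψ := Ψ) (ρ := ρ) hsi (DFunLike.congr_fun hs) (DFunLike.congr_fun hi) hS
    (DFunLike.congr_fun hρs) (DFunLike.congr_fun hρi) h

theorem M_freeGroup_of_finite (X : Type u) [Finite X] : M (FreeGroup X) = ⊥ := by
  induction X using Finite.induction_empty_option with
  | of_equiv e h => exact M_eq_bot_of_mulEquiv (FreeGroup.freeGroupCongr e) h
  | h_empty =>
    have h : MonoidHom.id (ExtSquare (FreeGroup PEmpty.{u + 1})) = 1 :=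
      ExtSquare.hom_ext fun x y => by
        rw [Subsingleton.elim x y, wedge_self]
        simp
    rw [eq_bot_iff]
    exact fun w _ => DFunLike.congr_fun h w
  | h_option h => exact M_freeGroup_option h

theorem range_freeGroupMap_mono {X : Type u} {Y Z : Finset X} (h : Y ⊆ Z) :
    (FreeGroup.map ((↑) : Y → X)).range ≤ (FreeGroup.map ((↑) : Z → X)).range := by
  rintro _ ⟨w, rfl⟩
  exact ⟨FreeGroup.map (fun y => ⟨y.1, h y.2⟩) w, by rw [FreeGroup.map.comp]; rfl⟩

theorem range_extSquareMap_mono {X : Type u} {Y Z : Finset X} (h : Y ⊆ Z) :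
    (ExtSquare.map (FreeGroup.map ((↑) : Y → X))).range ≤
      (ExtSquare.map (FreeGroup.map ((↑) : Z → X))).range := by
  rintro _ ⟨w, rfl⟩
  have : ExtSquare.map (FreeGroup.map ((↑) : Y → X)) =
      (ExtSquare.map (FreeGroup.map ((↑) : Z → X))).comp
        (ExtSquare.map (FreeGroup.map fun y : Y => (⟨y.1, h y.2⟩ : Z))) :=
    ExtSquare.hom_ext fun x y => by simp [FreeGroup.map.comp, Function.comp_def]
  rw [this]
  exact ⟨_, rfl⟩

theorem exists_finset_mem_range_freeGroupMap {X : Type u} (w : FreeGroup X) :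
    ∃ Y : Finset X, w ∈ (FreeGroup.map ((↑) : Y → X)).range := by
  classical
  have hw : w ∈ Subgroup.closure (Set.range FreeGroup.of) := by
    rw [FreeGroup.closure_range_of]
    exact Subgroup.mem_top w
  induction hw using Subgroup.closure_induction with
  | one => exact ⟨∅, one_mem _⟩
  | mem x hx => obtain ⟨x, rfl⟩ := hx; exact ⟨{x}, FreeGroup.of ⟨x, by simp⟩, by simp⟩
  | inv x _ h => obtain ⟨Y, h⟩ := h; exact ⟨Y, inv_mem h⟩
  | mul x y _ _ hx hy =>
    obtain ⟨Y, hY⟩ := hx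
    obtain ⟨Z, hZ⟩ := hy
    exact ⟨Y ∪ Z, mul_mem (range_freeGroupMap_mono Finset.subset_union_left hY)
      (range_freeGroupMap_mono Finset.subset_union_right hZ)⟩

theorem exists_finset_mem_range_extSquareMap {X : Type u} (w : ExtSquare (FreeGroup X)) :
    ∃ Y : Finset X, w ∈ (ExtSquare.map (FreeGroup.map ((↑) : Y → X))).range := by
  classical
  have hw : w ∈ Subgroup.closure {w : ExtSquare (FreeGroup X) | ∃ x y, w = wedge x y} := by
    rw [ExtSquare.closure_wedge]
    exact Subgroup.mem_top w
  induction hw using Subgroup.closure_induction with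
  | one => exact ⟨∅, one_mem _⟩
  | mem w hw =>
    obtain ⟨x, y, rfl⟩ := hw
    obtain ⟨Y, hY⟩ := exists_finset_mem_range_freeGroupMap x
    obtain ⟨Z, hZ⟩ := exists_finset_mem_range_freeGroupMap y
    obtain ⟨x, rfl⟩ := range_freeGroupMap_mono (Finset.subset_union_left (s₂ := Z)) hY
    obtain ⟨y, rfl⟩ := range_freeGroupMap_mono (Finset.subset_union_right (s₁ := Y)) hZ
    exact ⟨Y ∪ Z, wedge x y, ExtSquare.map_wedge _ _ _⟩
  | inv x _ h => obtain ⟨Y, h⟩ := h; exact ⟨Y, inv_mem h⟩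
  | mul x y _ _ hx hy =>
    obtain ⟨Y, hY⟩ := hx
    obtain ⟨Z, hZ⟩ := hy
    exact ⟨Y ∪ Z, mul_mem (range_extSquareMap_mono Finset.subset_union_left hY)
      (range_extSquareMap_mono Finset.subset_union_right hZ)⟩

/-- The Schur multiplier of a free group is trivial. -/
theorem M_freeGroup (X : Type u) : M (FreeGroup X) = ⊥ := by
  rw [eq_bot_iff]
  intro w hw
  obtain ⟨Y, w, rfl⟩ := exists_finset_mem_range_extSquareMap w
  -- The commutator already vanishes over `Y`, since `FreeGroup Y` embeds in `FreeGroup X`;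
  -- injectivity on exterior squares is not needed.
  have h : w ∈ M (FreeGroup Y) := by
    refine MonoidHom.mem_ker.mpr (Subtype.ext ?_)
    apply FreeGroup.map_injective (Subtype.val_injective (p := (· ∈ Y)))
    rw [Subgroup.coe_one, map_one]
    exact (commHom_map _ w).symm.trans (congrArg Subtype.val hw)
  rw [M_freeGroup_of_finite, Subgroup.mem_bot] at h
  rw [h, map_one]
  exact one_mem _

end FreeGroup

/-! ### Isoclinism in terms of kernels -/

section Isoclinism

variable {N G F : Type u} [Group N] [Group G] [Group F]

theorem extCommHom_apply_wedge (e : GroupExtension N G F) (he : IsCentral e) (x y : F) :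
    extCommHom e he (wedge x y) = commMap e x y := by
  rw [extCommHom, ExtSquare.lift_wedge]

theorem extCommHom_surjective (e : GroupExtension N G F) (he : IsCentral e) :
    Function.Surjective (extCommHom e he) := by
  have h : commutator G ≤ ((commutator G).subtype.comp (extCommHom e he)).range := by
    refine (commutator_eq_closure G).trans_le ((Subgroup.closure_le _).mpr ?_)
    rintro _ ⟨a, b, rfl⟩
    -- The inverses convert `a * b * a⁻¹ * b⁻¹` into the convention of `comm`.
    refine ⟨wedge (e.rightHom a⁻¹) (e.rightHom b⁻¹), ?_⟩
    change (extCommHom e he _ : G) = _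
    rw [extCommHom_wedge, comm, inv_inv, inv_inv, commutatorElement_def]
  intro z
  obtain ⟨w, hw⟩ := h z.2
  exact ⟨w, Subtype.ext hw⟩

theorem ker_extCommHom_le (e : GroupExtension N G F) (he : IsCentral e) :
    (extCommHom e he).ker ≤ M F := by
  intro w hw
  refine MonoidHom.mem_ker.mpr (Subtype.ext ?_)
  rw [← rightHom_extCommHom e he, MonoidHom.mem_ker.mp hw, Subgroup.coe_one, map_one,
    Subgroup.coe_one]

theorem mk_mem_ker_thetaTilde (e : GroupExtension N G F) (he : IsCentral e) (hcp : IsCP e)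
    (w : M F) : (w : B₀ F) ∈ (thetaTilde e he hcp).ker ↔
      (w : ExtSquare F) ∈ (extCommHom e he).ker := by
  have h : thetaTilde e he hcp (w : B₀ F) = theta e he w := rfl
  rw [MonoidHom.mem_ker, MonoidHom.mem_ker, h, ← map_eq_one_iff e.inl e.inl_injective, inl_theta,
    OneMemClass.coe_eq_one]

theorem B₀.map_symm_map {R : Type u} [Group R] (f : F ≃* R) (b : B₀ F) :
    B₀.map f.symm.toMonoidHom (B₀.map f.toMonoidHom b) = b := by
  rw [← MonoidHom.comp_apply, ← B₀.map_comp,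
    show f.symm.toMonoidHom.comp f.toMonoidHom = MonoidHom.id F from
      MonoidHom.ext f.symm_apply_apply, B₀.map_id]
  rfl

theorem B₀.map_bijective {R : Type u} [Group R] (f : F ≃* R) :
    Function.Bijective (B₀.map f.toMonoidHom) :=
  ⟨Function.LeftInverse.injective (g := B₀.map f.symm.toMonoidHom) (B₀.map_symm_map f),
    Function.RightInverse.surjective (g := B₀.map f.symm.toMonoidHom) (B₀.map_symm_map f.symm)⟩

variable {N₁ G₁ F₁ N₂ G₂ F₂ : Type u} [Group N₁] [Group G₁] [Group F₁]
    [Group N₂] [Group G₂] [Group F₂]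
    {e₁ : GroupExtension N₁ G₁ F₁} {e₂ : GroupExtension N₂ G₂ F₂}

/-- Since the wedges generate, `ξ` has to be the map induced by `η ∧ η` between the quotients of the
exterior squares that are isomorphic to `G₁'` and `G₂'`; it exists as an isomorphism exactly when
the kernels match. -/
theorem exists_commutator_mulEquiv_iff (he₁ : IsCentral e₁) (he₂ : IsCentral e₂) (η : F₁ ≃* F₂) :
    (∃ ξ : commutator G₁ ≃* commutator G₂,
      ∀ x y : F₁, ξ (commMap e₁ x y) = commMap e₂ (η x) (η y)) ↔
    (extCommHom e₁ he₁).ker = (extCommHom e₂ he₂).ker.comap (ExtSquare.map η.toMonoidHom) := by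
  constructor
  · rintro ⟨ξ, hξ⟩
    have h : ξ.toMonoidHom.comp (extCommHom e₁ he₁) =
        (extCommHom e₂ he₂).comp (ExtSquare.map η.toMonoidHom) :=
      ExtSquare.hom_ext fun x y => by simp [extCommHom_apply_wedge, hξ]
    rw [MonoidHom.comap_ker, ← h]
    exact (MonoidHom.ker_mulEquiv_comp _ ξ).symm
  · intro h
    have hsurj : Function.Surjective
        ((extCommHom e₂ he₂).comp (ExtSquare.map η.toMonoidHom)) := by
      have h' : (ExtSquare.map η.toMonoidHom).comp (ExtSquare.map η.symm.toMonoidHom) =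
          MonoidHom.id _ := ExtSquare.hom_ext fun x y => by simp
      exact (extCommHom_surjective e₂ he₂).comp (Function.RightInverse.surjective
        (g := ExtSquare.map η.symm.toMonoidHom) (DFunLike.congr_fun h'))
    rw [MonoidHom.comap_ker] at h
    refine ⟨(QuotientGroup.quotientKerEquivOfSurjective _
      (extCommHom_surjective e₁ he₁)).symm.trans ((QuotientGroup.quotientMulEquivOfEq h).trans
        (QuotientGroup.quotientKerEquivOfSurjective _ hsurj)), fun x y => ?_⟩
    have h₁ : (QuotientGroup.quotientKerEquivOfSurjective _
        (extCommHom_surjective e₁ he₁)).symm (commMap e₁ x y) =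
          ((wedge x y : ExtSquare F₁) : ExtSquare F₁ ⧸ (extCommHom e₁ he₁).ker) := by
      rw [MulEquiv.symm_apply_eq, ← extCommHom_apply_wedge e₁ he₁]
      rfl
    rw [MulEquiv.trans_apply, h₁, MulEquiv.trans_apply, QuotientGroup.quotientMulEquivOfEq_mk]
    change extCommHom e₂ he₂ (ExtSquare.map η.toMonoidHom (wedge x y)) = _
    rw [ExtSquare.map_wedge, extCommHom_apply_wedge]
    rfl

/-- Both kernels lie in `M` and are the preimages of the kernels in `B₀`, so no information is lost
in passing to the quotient. -/
theorem ker_extCommHom_eq_comap_iff (he₁ : IsCentral e₁) (he₂ : IsCentral e₂) (h₁ : IsCP e₁)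
    (h₂ : IsCP e₂) (η : F₁ ≃* F₂) :
    (extCommHom e₁ he₁).ker = (extCommHom e₂ he₂).ker.comap (ExtSquare.map η.toMonoidHom) ↔
    (thetaTilde e₁ he₁ h₁).ker.map (B₀.map η.toMonoidHom) = (thetaTilde e₂ he₂ h₂).ker := by
  have key : (thetaTilde e₁ he₁ h₁).ker.map (B₀.map η.toMonoidHom) = (thetaTilde e₂ he₂ h₂).ker ↔
      (thetaTilde e₁ he₁ h₁).ker = (thetaTilde e₂ he₂ h₂).ker.comap (B₀.map η.toMonoidHom) := by
    constructor
    · intro h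
      rw [← h, Subgroup.comap_map_eq_self_of_injective (B₀.map_bijective η).1]
    · intro h
      rw [h, Subgroup.map_comap_eq_self_of_surjective (B₀.map_bijective η).2]
  have hmap : ∀ w : M F₁, B₀.map η.toMonoidHom (w : B₀ F₁) = (M.map η.toMonoidHom w : B₀ F₂) :=
    fun _ => rfl
  rw [key]
  constructor
  · intro h
    ext b
    obtain ⟨w, rfl⟩ := QuotientGroup.mk_surjective b
    rw [Subgroup.mem_comap, hmap, mk_mem_ker_thetaTilde, mk_mem_ker_thetaTilde, h]
    rfl
  · intro h
    have hM : ∀ w : M F₁, (w : ExtSquare F₁) ∈ (extCommHom e₁ he₁).ker ↔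
        ExtSquare.map η.toMonoidHom w ∈ (extCommHom e₂ he₂).ker := by
      intro w
      rw [← mk_mem_ker_thetaTilde e₁ he₁ h₁, h, Subgroup.mem_comap, hmap, mk_mem_ker_thetaTilde]
      rfl
    ext w
    refine ⟨fun hw => (hM ⟨w, ker_extCommHom_le e₁ he₁ hw⟩).mp hw, fun hw => ?_⟩
    -- Applying `η⁻¹` shows that `w` itself lies in `M F₁`, where `hM` is available.
    have hw' : ExtSquare.map η.symm.toMonoidHom (ExtSquare.map η.toMonoidHom w) ∈ M F₁ :=
      map_mem_M _ (ker_extCommHom_le e₂ he₂ hw)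
    have hinv : (ExtSquare.map η.symm.toMonoidHom).comp (ExtSquare.map η.toMonoidHom) =
        MonoidHom.id _ := ExtSquare.hom_ext fun x y => by simp
    rw [← MonoidHom.comp_apply, hinv] at hw'
    exact (hM ⟨w, hw'⟩).mpr hw

theorem isoclinic_iff (he₁ : IsCentral e₁) (he₂ : IsCentral e₂) (h₁ : IsCP e₁) (h₂ : IsCP e₂) :
    Isoclinic e₁ e₂ ↔ ∃ η : F₁ ≃* F₂,
      (thetaTilde e₁ he₁ h₁).ker.map (B₀.map η.toMonoidHom) = (thetaTilde e₂ he₂ h₂).ker :=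
  exists_congr fun η => (exists_commutator_mulEquiv_iff he₁ he₂ η).trans
    (ker_extCommHom_eq_comap_iff he₁ he₂ h₁ h₂ η)

end Isoclinism

/-! ### Realizing a subgroup of `B₀(Q)` by an extension -/

section Realization

variable {Γ Q : Type u} [Group Γ] [Group Q]

/-- The preimage in `Q ∧ Q` of a subgroup of `B₀(Q)`. -/
def liftSubgroup (U : Subgroup (B₀ Q)) : Subgroup (ExtSquare Q) :=
  (U.comap (QuotientGroup.mk' _)).map (M Q).subtype

theorem coe_mem_liftSubgroup {U : Subgroup (B₀ Q)} {w : M Q} :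
    (w : ExtSquare Q) ∈ liftSubgroup U ↔ (w : B₀ Q) ∈ U := by
  simp [liftSubgroup]

theorem liftSubgroup_le (U : Subgroup (B₀ Q)) : liftSubgroup U ≤ M Q :=
  Subgroup.map_subtype_le _

theorem M₀_le_liftSubgroup (U : Subgroup (B₀ Q)) : M₀ Q ≤ liftSubgroup U := by
  intro w hw
  refine (coe_mem_liftSubgroup (w := ⟨w, M₀_le_M hw⟩)).mpr ?_
  rw [(QuotientGroup.eq_one_iff _).mpr (Subgroup.mem_subgroupOf.mpr hw)]
  exact one_mem U

/-- The commutators in `Γ` of the elements of `Γ ∧ Γ` that `π : Γ → Q` maps into the preimage of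
`U` in `Q ∧ Q`. -/
def relationSubgroup (π : Γ →* Q) (U : Subgroup (B₀ Q)) : Subgroup Γ :=
  ((liftSubgroup U).comap (ExtSquare.map π)).map ((commutator Γ).subtype.comp (commHom Γ))

theorem commHom_mem_relationSubgroup {π : Γ →* Q} {U : Subgroup (B₀ Q)} {w : ExtSquare Γ}
    (hw : ExtSquare.map π w ∈ liftSubgroup U) : (commHom Γ w : Γ) ∈ relationSubgroup π U :=
  ⟨w, hw, rfl⟩

/-- The wedge of two commuting elements lies in `M₀(Q)`, hence in the preimage of every `U`.
Normality of the relation subgroup, centrality and the CP property all rest on this. -/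
theorem comm_mem_relationSubgroup {π : Γ →* Q} (U : Subgroup (B₀ Q)) {x y : Γ}
    (h : comm (π x) (π y) = 1) : comm x y ∈ relationSubgroup π U := by
  rw [← commHom_wedge]
  apply commHom_mem_relationSubgroup
  rw [ExtSquare.map_wedge]
  exact M₀_le_liftSubgroup U (Subgroup.subset_closure ⟨_, _, h, rfl⟩)

theorem relationSubgroup_le (π : Γ →* Q) (U : Subgroup (B₀ Q)) :
    relationSubgroup π U ≤ π.ker := by
  rintro _ ⟨w, hw, rfl⟩
  rw [MonoidHom.mem_ker]
  change π (commHom Γ w) = 1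
  rw [← commHom_map, show commHom Q (ExtSquare.map π w) = 1 from liftSubgroup_le U hw]
  rfl

/-- The relation subgroup lies in `π.ker` and contains all commutators of `Γ` with `π.ker`, so a
conjugate differs from the element by a member. -/
instance relationSubgroup_normal (π : Γ →* Q) (U : Subgroup (B₀ Q)) :
    (relationSubgroup π U).Normal where
  conj_mem n hn g := by
    have h : comm g⁻¹ n⁻¹ ∈ relationSubgroup π U := by
      apply comm_mem_relationSubgroup
      rw [map_inv, map_inv, MonoidHom.mem_ker.mp (relationSubgroup_le π U hn)]
      simp [comm]
    have e : g * n * g⁻¹ = comm g⁻¹ n⁻¹ * n := by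
      simp [comm]
    rw [e]
    exact mul_mem h hn

/-- The extension `ker π / V → Γ / V → Q`, where `V` is the relation subgroup of `U`. -/
def relationExtension (π : Γ →* Q) (hπ : Function.Surjective π) (U : Subgroup (B₀ Q)) :
    GroupExtension (QuotientGroup.lift (relationSubgroup π U) π (relationSubgroup_le π U)).ker
      (Γ ⧸ relationSubgroup π U) Q where
  inl := Subgroup.subtype _
  rightHom := QuotientGroup.lift (relationSubgroup π U) π (relationSubgroup_le π U)
  inl_injective := Subtype.val_injective
  range_inl_eq_ker_rightHom := Subgroup.range_subtype _
  rightHom_surjective := QuotientGroup.lift_surjective_of_surjective _ _ hπ _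

variable {π : Γ →* Q} (hπ : Function.Surjective π) (U : Subgroup (B₀ Q))

theorem commute_mk_of_comm_eq_one {x y : Γ} (h : comm (π x) (π y) = 1) :
    Commute (x : Γ ⧸ relationSubgroup π U) (y : Γ ⧸ relationSubgroup π U) := by
  rw [← comm_eq_one_iff]
  exact (map_comm (QuotientGroup.mk' (relationSubgroup π U)) x y).symm.trans
    ((QuotientGroup.eq_one_iff _).mpr (comm_mem_relationSubgroup U h))

theorem relationExtension_isCentral : IsCentral (relationExtension π hπ U) := by
  intro z hz
  rw [GroupExtension.range_inl_eq_ker_rightHom] at hz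
  obtain ⟨x, rfl⟩ := QuotientGroup.mk_surjective z
  rw [Subgroup.mem_center_iff]
  intro y
  obtain ⟨y, rfl⟩ := QuotientGroup.mk_surjective y
  have hx : π x = 1 := hz
  refine commute_mk_of_comm_eq_one U ?_
  rw [hx]
  simp [comm]

theorem relationExtension_isCP : IsCP (relationExtension π hπ U) := by
  intro x y hxy
  obtain ⟨x, rfl⟩ := hπ x
  obtain ⟨y, rfl⟩ := hπ y
  exact ⟨x, y, rfl, rfl, commute_mk_of_comm_eq_one U ((comm_eq_one_iff _ _).mpr hxy)⟩

/-- On generators, `x` and `y` themselves provide lifts of `π x` and `π y` to the quotient, so the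
commutator can be computed in `Γ`. -/
theorem extCommHom_relationExtension (w : ExtSquare Γ) :
    (extCommHom (relationExtension π hπ U) (relationExtension_isCentral hπ U)
      (ExtSquare.map π w) : Γ ⧸ relationSubgroup π U) = (commHom Γ w : Γ) := by
  have h : ((commutator (Γ ⧸ relationSubgroup π U)).subtype.comp
      (extCommHom (relationExtension π hπ U) (relationExtension_isCentral hπ U))).comp
        (ExtSquare.map π) = (QuotientGroup.mk' (relationSubgroup π U)).comp
          ((commutator Γ).subtype.comp (commHom Γ)) := by
    refine ExtSquare.hom_ext fun x y => ?_
    change ((extCommHom _ (relationExtension_isCentral hπ U) (ExtSquare.map π (wedge x y)) :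
      commutator (Γ ⧸ relationSubgroup π U)) : Γ ⧸ relationSubgroup π U) = QuotientGroup.mk' _ (commHom Γ (wedge x y) : Γ)
    rw [ExtSquare.map_wedge, commHom_wedge, map_comm]
    exact extCommHom_wedge (relationExtension π hπ U) _ (x : Γ ⧸ relationSubgroup π U) y
  exact DFunLike.congr_fun h w

theorem extSquareMap_surjective (hπ : Function.Surjective π) :
    Function.Surjective (ExtSquare.map π) := by
  rw [← MonoidHom.range_eq_top, eq_top_iff, ← ExtSquare.closure_wedge, Subgroup.closure_le]
  rintro _ ⟨x, y, rfl⟩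
  obtain ⟨x, rfl⟩ := hπ x
  obtain ⟨y, rfl⟩ := hπ y
  exact ⟨wedge x y, ExtSquare.map_wedge _ _ _⟩

theorem ker_thetaTilde_relationExtension (hΓ : M Γ = ⊥) :
    (thetaTilde (relationExtension π hπ U) (relationExtension_isCentral hπ U)
      (relationExtension_isCP hπ U)).ker = U := by
  ext b
  obtain ⟨w, rfl⟩ := QuotientGroup.mk_surjective b
  rw [mk_mem_ker_thetaTilde, ← coe_mem_liftSubgroup, MonoidHom.mem_ker]
  obtain ⟨v, hv⟩ := extSquareMap_surjective hπ (w : ExtSquare Q)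
  rw [← hv, ← OneMemClass.coe_eq_one, extCommHom_relationExtension, QuotientGroup.eq_one_iff]
  refine ⟨?_, commHom_mem_relationSubgroup⟩
  -- Membership only yields some `v'` with the same commutator as `v`; triviality of `M Γ` forces
  -- `v' = v`.
  rintro ⟨v', hv', h⟩
  have h' : commHom Γ v' = commHom Γ v := Subtype.ext h
  have hinj : Function.Injective (commHom Γ) := (MonoidHom.ker_eq_bot_iff _).mp hΓ
  rw [← hinj h']
  exact hv'

end Realization

/-! ### Isoclinism classes and orbits -/

section Classification

variable {Q : Type u} [Group Q]

/-- The orbit of subgroups of `B₀(Q)` attached to a central CP extension and an identification of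
its factor group with `Q`. -/
noncomputable def kernelOrbit (e : CentralCPExtension Q) (α : e.F ≃* Q) : SubgroupOrbits Q :=
  Quotient.mk (MulAction.orbitRel (MulAut Q) (Subgroup (B₀ Q)))
    ((thetaTilde e.ext e.central e.cp).ker.map (B₀.map α.toMonoidHom))

theorem kernelOrbit_eq_iff {e₁ e₂ : CentralCPExtension Q} (α₁ : e₁.F ≃* Q) (α₂ : e₂.F ≃* Q) :
    kernelOrbit e₁ α₁ = kernelOrbit e₂ α₂ ↔ Isoclinic e₁.ext e₂.ext := by
  -- Swapping the sides makes the orbit relation give a `φ` from the first kernel to the second, the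
  -- direction of `η`; the two correspond by `η = α₂⁻¹ ∘ φ ∘ α₁`.
  rw [isoclinic_iff e₁.central e₂.central e₁.cp e₂.cp, eq_comm, kernelOrbit, kernelOrbit,
    Quotient.eq, MulAction.orbitRel_apply, MulAction.mem_orbit_iff]
  have hsmul : ∀ (φ : MulAut Q) (U : Subgroup (B₀ Q)),
    φ • U = U.map (B₀.map (φ : Q ≃* Q).toMonoidHom) := fun _ _ => rfl
  simp only [hsmul, Subgroup.map_map, ← B₀.map_comp]
  constructor
  · rintro ⟨φ, hφ⟩
    refine ⟨(α₁.trans φ).trans α₂.symm, ?_⟩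
    have h := congrArg (Subgroup.map (B₀.map α₂.symm.toMonoidHom)) hφ
    rw [Subgroup.map_map, Subgroup.map_map, ← B₀.map_comp, ← B₀.map_comp,
      show α₂.symm.toMonoidHom.comp α₂.toMonoidHom = MonoidHom.id e₂.F from
        MonoidHom.ext α₂.symm_apply_apply, B₀.map_id, Subgroup.map_id] at h
    exact h
  · rintro ⟨η, hη⟩
    refine ⟨(α₁.symm.trans η).trans α₂, ?_⟩
    rw [← hη, Subgroup.map_map, ← B₀.map_comp]
    congr 2
    ext x
    simp

theorem kernelOrbit_surjective (c : SubgroupOrbits Q) :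
    ∃ (e : CentralCPExtension Q) (α : e.F ≃* Q), kernelOrbit e α = c := by
  induction c using Quotient.inductionOn with | h U => ?_
  -- The free group on the underlying set of `Q` serves as `Γ`.
  have hπ : Function.Surjective (FreeGroup.lift (id : Q → Q)) := fun q =>
    ⟨FreeGroup.of q, FreeGroup.lift_apply_of⟩
  refine ⟨⟨_, _, _, relationExtension _ hπ U, relationExtension_isCentral hπ U,
    relationExtension_isCP hπ U, ⟨MulEquiv.refl Q⟩⟩, MulEquiv.refl Q, ?_⟩
  rw [kernelOrbit]
  congr 1
  refine (congrArg _ (ker_thetaTilde_relationExtension hπ U (M_freeGroup Q))).trans ?_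
  exact (congrArg (U.map ·) B₀.map_id).trans (Subgroup.map_id U)

end Classification

end CPExt

theorem theorem3p8 {Q : Type u} [Group Q] :
    ∃ Φ : CPExt.IsoclinismClasses Q ≃ CPExt.SubgroupOrbits Q,
      ∀ (e : CPExt.CentralCPExtension Q) (α : e.F ≃* Q),
        Φ (Quotient.mk (CPExt.isoclinismSetoid Q) e) =
          Quotient.mk (MulAction.orbitRel (MulAut Q) (Subgroup (CPExt.B₀ Q)))
            ((CPExt.thetaTilde e.ext e.central e.cp).ker.map
              (CPExt.B₀.map α.toMonoidHom)) := by
  let Φ : CPExt.IsoclinismClasses Q → CPExt.SubgroupOrbits Q :=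
    Quotient.lift (fun e => CPExt.kernelOrbit e e.factor_iso.some)
      fun _ _ h => (CPExt.kernelOrbit_eq_iff _ _).mpr h
  -- The identification chosen in `Φ` is immaterial: `e` is isoclinic to itself, so any two
  -- identifications of its factor group give the same orbit.
  have hΦ : ∀ (e : CPExt.CentralCPExtension Q) (α : e.F ≃* Q),
      Φ (Quotient.mk (CPExt.isoclinismSetoid Q) e) = CPExt.kernelOrbit e α := fun e α =>
    (CPExt.kernelOrbit_eq_iff _ _).mpr ((CPExt.isoclinismSetoid Q).refl e)
  refine ⟨Equiv.ofBijective Φ ⟨?_, ?_⟩, hΦ⟩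
  · rintro ⟨e₁⟩ ⟨e₂⟩ h
    exact Quotient.sound ((CPExt.kernelOrbit_eq_iff _ _).mp h)
  · intro c
    obtain ⟨e, α, h⟩ := CPExt.kernelOrbit_surjective c
    exact ⟨Quotient.mk _ e, (hΦ e α).trans h⟩
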